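/- Let $n$ be a natural number, let $\mathbb{D}^n=\{z\in\mathbb{C}^n: |z_i|<1 \text{ for } i=1,\dots,n\}$ be the open unit polydisc, and let $\phi=(\phi_1,\dots,\phi_n):\mathbb{D}^n\to\mathbb{D}^n$ be holomorphic. Let $H^2(\mathbb{D}^n)$ be the Hardy space of all holomorphic $f:\mathbb{D}^n\to\mathbb{C}$ with $$\|f\|^2_{H^2}=\sup_{0\le r<1}\int_{\mathbb{T}^n}|f(r\zeta)|^2\,dm_n(\zeta)<\infty,$$ where $m_n$ is the normalized Lebesgue measure on the torus $\mathbb{T}^n$. For real $\alpha>-1$ let $A^2_\alpha(\mathbb{D}^n)$ be the weighted Bergman space of all holomorphic $f:\mathbb{D}^n\to\mathbb{C}$ with $$\|f\|^2_{A^2_\alpha}=\int_{\mathbb{D}^n}|f(z)|^2\prod_{i=1}^n(1-|z_i|^2)^\alpha\,dA_n(z)<\infty,$$ where $A_n$ is the Lebesgue volume measure on $\mathbb{D}^n$ normalized to total mass one. Write $C_\phi f=f\circ\phi$, and let $\|C_\phi\|$ be the operator norm of $C_\phi$ on the space in question. 1. If $C_\phi$ is a bounded operator from $H^2(\mathbb{D}^n)$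 to itself, then $$\sup_{z\in\mathbb{D}^n}\ \prod_{i=1}^n\frac{1-|z_i|^2}{1-|\phi_i(z)|^2}\ \le\ \|C_\phi\|^2 .$$ 2. For every real $\alpha>-1$, if $C_\phi$ is a bounded operator from $A^2_\alpha(\mathbb{D}^n)$ to itself, then $$\sup_{z\in\mathbb{D}^n}\ \prod_{i=1}^n\left(\frac{1-|z_i|^2}{1-|\phi_i(z)|^2}\right)^{\alpha+2}\ \le\ \|C_\phi\|^2 .$$ In particular, both suprema are finite under the respective hypothesis. -/

import Mathlib

open MeasureTheory
open scoped ENNReal Topology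

/-- The open unit polydisc of `ℂⁿ`. -/
def polydisc (n : ℕ) : Set (Fin n → ℂ) := {z | ∀ i, ‖z i‖ < 1}

/-- A function on the polydisc is holomorphic: it is the restriction of a function on `ℂⁿ` that is
complex differentiable on the (open) polydisc. -/
def IsHolomorphic {n : ℕ} (f : polydisc n → ℂ) : Prop :=
  ∃ F : (Fin n → ℂ) → ℂ, DifferentiableOn ℂ F (polydisc n) ∧ ∀ z : polydisc n, F z = f z

/-- The normalized Lebesgue measure on the circle, in the angular coordinate `θ ∈ (0, 2π]`. -/
noncomputable def angleMeasure : Measure ℝ :=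
  (ENNReal.ofReal (2 * Real.pi))⁻¹ • volume.restrict (Set.Ioc 0 (2 * Real.pi))

instance : IsProbabilityMeasure angleMeasure := by
  refine ⟨?_⟩
  rw [angleMeasure, Measure.smul_apply, Measure.restrict_apply_univ, Real.volume_Ioc, sub_zero,
    smul_eq_mul]
  exact ENNReal.inv_mul_cancel (ENNReal.ofReal_pos.2 Real.two_pi_pos).ne' ENNReal.ofReal_ne_top

/-- The normalized Lebesgue measure on the torus `𝕋ⁿ`, in the angular coordinates. -/
noncomputable def torusMeasure (n : ℕ) : Measure (Fin n → ℝ) :=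
  Measure.pi fun _ => angleMeasure

/-- The point `r ζ = (r e^{iθ₁}, …, r e^{iθₙ})` of the polydisc, for `0 ≤ r < 1`. -/
noncomputable def torusPoint {n : ℕ} (r : Set.Ico (0 : ℝ) 1) (θ : Fin n → ℝ) : polydisc n :=
  ⟨fun i => circleMap 0 r (θ i), fun i => by
    rw [norm_circleMap_zero, abs_of_nonneg r.2.1]; exact r.2.2⟩

/-- `sup_{0 ≤ r < 1} (∫_{𝕋ⁿ} |f (r ζ)|² dm_n(ζ))^{1/2}`, possibly infinite. -/
noncomputable def hardyENorm {n : ℕ} (f : polydisc n → ℂ) : ℝ≥0∞ :=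
  ⨆ r : Set.Ico (0 : ℝ) 1, eLpNorm (fun θ => f (torusPoint r θ)) 2 (torusMeasure n)

/-- The measure `∏ (1 - |z_i|²)^α dA_n(z)` on the polydisc, where `A_n` is the Lebesgue volume
normalized to total mass one. -/
noncomputable def bergmanMeasure (n : ℕ) (α : ℝ) : Measure (polydisc n) :=
  ((volume (polydisc n))⁻¹ •
    (volume : Measure (Fin n → ℂ)).comap ((↑) : polydisc n → Fin n → ℂ)).withDensity
    fun z => ENNReal.ofReal (∏ i, (1 - ‖z.1 i‖ ^ 2) ^ α)

/-- `(∫_{𝔻ⁿ} |f(z)|² ∏ (1 - |z_i|²)^α dA_n(z))^{1/2}`, possibly infinite. -/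
noncomputable def bergmanENorm {n : ℕ} (α : ℝ) (f : polydisc n → ℂ) : ℝ≥0∞ :=
  eLpNorm f 2 (bergmanMeasure n α)

theorem isOpen_polydisc (n : ℕ) : IsOpen (polydisc n) := by
  simp only [polydisc, Set.ofPred_forall]
  exact isOpen_iInter_of_finite fun i => isOpen_lt (by fun_prop) continuous_const

namespace IsHolomorphic

variable {n : ℕ} {f g : polydisc n → ℂ}

theorem continuous (hf : IsHolomorphic f) : Continuous f := by
  obtain ⟨F, hF, h⟩ := hf
  have : f = (polydisc n).domRestrict F := by ext z; exact (h z).symm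
  rw [this]
  exact hF.continuousOn.domRestrict

theorem zero : IsHolomorphic (0 : polydisc n → ℂ) :=
  ⟨0, differentiableOn_const 0, fun _ => rfl⟩

theorem add (hf : IsHolomorphic f) (hg : IsHolomorphic g) : IsHolomorphic (f + g) := by
  obtain ⟨F, hF, h⟩ := hf
  obtain ⟨G, hG, k⟩ := hg
  exact ⟨F + G, hF.add hG, fun z => by simp [h, k]⟩

theorem smul (c : ℂ) (hf : IsHolomorphic f) : IsHolomorphic (c • f) := by
  obtain ⟨F, hF, h⟩ := hf
  exact ⟨c • F, hF.const_smul c, fun z => by simp [h]⟩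

end IsHolomorphic

theorem continuous_torusPoint {n : ℕ} (r : Set.Ico (0 : ℝ) 1) :
    Continuous (torusPoint (n := n) r) := by
  refine Continuous.subtype_mk (continuous_pi fun i => ?_) _
  exact (continuous_circleMap 0 _).comp (continuous_apply i)

section HardyENorm

variable {n : ℕ} {f g : polydisc n → ℂ}

theorem hardyENorm_zero : hardyENorm (0 : polydisc n → ℂ) = 0 := by
  simp [hardyENorm]

theorem hardyENorm_add_le (hf : IsHolomorphic f) (hg : IsHolomorphic g) :
    hardyENorm (f + g) ≤ hardyENorm f + hardyENorm g := by
  refine iSup_le fun r => ?_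
  refine (eLpNorm_add_le (hf.continuous.comp (continuous_torusPoint r)).aestronglyMeasurable
    (hg.continuous.comp (continuous_torusPoint r)).aestronglyMeasurable (by norm_num)).trans ?_
  exact add_le_add
    (le_iSup (fun r => eLpNorm (fun θ => f (torusPoint r θ)) 2 (torusMeasure n)) r)
    (le_iSup (fun r => eLpNorm (fun θ => g (torusPoint r θ)) 2 (torusMeasure n)) r)

theorem hardyENorm_smul (c : ℂ) : hardyENorm (c • f) = ‖c‖ₑ * hardyENorm f := by
  rw [hardyENorm, hardyENorm, ENNReal.mul_iSup]
  exact iSup_congr fun r => eLpNorm_const_smul c (fun θ => f (torusPoint r θ)) 2 _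

/-- A holomorphic function that vanishes almost everywhere on a torus vanishes at the points of the
torus all of whose angles lie in the open interval. -/
theorem eq_zero_of_torus_ae (r : Set.Ico (0 : ℝ) 1) (hf : IsHolomorphic f)
    (h : (fun θ => f (torusPoint r θ)) =ᵐ[torusMeasure n] 0) (θ : Fin n → ℝ)
    (hθ : ∀ i, θ i ∈ Set.Ioo 0 (2 * Real.pi)) : f (torusPoint r θ) = 0 := by
  by_contra hne
  have hcont := hf.continuous.comp (continuous_torusPoint (n := n) r)
  have hopen : IsOpen {t : Fin n → ℝ | f (torusPoint r t) ≠ 0} :=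
    isOpen_ne_fun hcont continuous_const
  obtain ⟨ε, hε, hsub⟩ := Metric.isOpen_iff.1 hopen θ hne
  have hzero : torusMeasure n (Metric.ball θ ε) = 0 :=
    measure_mono_null hsub (ae_iff.1 h)
  rw [ball_pi _ hε, torusMeasure, Measure.pi_pi, Finset.prod_eq_zero_iff] at hzero
  obtain ⟨i, -, hi⟩ := hzero
  rw [angleMeasure, Measure.smul_apply, smul_eq_mul, mul_eq_zero, Measure.restrict_apply measurableSet_ball] at hi
  rcases hi with hi | hi
  · exact absurd hi (ENNReal.inv_ne_zero.2 ENNReal.ofReal_ne_top)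
  · have hpos : 0 < volume (Metric.ball (θ i) ε ∩ Set.Ioo 0 (2 * Real.pi)) :=
      (Metric.isOpen_ball.inter isOpen_Ioo).measure_pos _ ⟨θ i, Metric.mem_ball_self hε, hθ i⟩
    exact absurd (measure_mono_null
      (Set.inter_subset_inter_right _ Set.Ioo_subset_Ioc_self) hi) hpos.ne'

/-- The Hardy norm is definite on holomorphic functions. -/
theorem eq_zero_of_hardyENorm_eq_zero (hf : IsHolomorphic f) (h0 : hardyENorm f = 0) :
    f = 0 := by
  let r : Set.Ico (0 : ℝ) 1 := ⟨1 / 2, by norm_num, by norm_num⟩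
  have h1 : ∀ θ : Fin n → ℝ, (∀ i, θ i ∈ Set.Ioo 0 (2 * Real.pi)) → f (torusPoint r θ) = 0 :=
    fun θ hθ => eq_zero_of_torus_ae r hf (by
      have h2 : eLpNorm (fun θ => f (torusPoint r θ)) 2 (torusMeasure n) = 0 :=
        le_antisymm (h0 ▸ le_iSup
          (fun r => eLpNorm (fun θ => f (torusPoint r θ)) 2 (torusMeasure n)) r) bot_le
      exact (eLpNorm_eq_zero_iff
        (hf.continuous.comp (continuous_torusPoint r)).aestronglyMeasurable (by norm_num)).1 h2)
      θ hθ
  obtain ⟨F, hF, hFf⟩ := hf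
  have key : ∀ S : Finset (Fin n), ∀ z ∈ polydisc n,
      (∀ i ∉ S, ∃ t ∈ Set.Ioo 0 (2 * Real.pi), z i = circleMap 0 (1 / 2) t) → F z = 0 := by
    intro S
    induction S using Finset.induction_on with
    | empty =>
      intro z hz h
      choose θ hθ hzθ using fun i => h i (Finset.notMem_empty i)
      have hz' : z = (torusPoint r θ : polydisc n) := funext hzθ
      rw [hz', hFf]
      exact h1 θ hθ
    | insert a S ha ih =>
      intro z hz h
      have hmem : ∀ w ∈ Metric.ball (0 : ℂ) 1, Function.update z a w ∈ polydisc n := by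
        intro w hw i
        rcases eq_or_ne i a with rfl | hi
        · simpa using hw
        · simpa [hi] using hz i
      have hd : DifferentiableOn ℂ (fun w => F (Function.update z a w)) (Metric.ball 0 1) :=
        hF.comp (fun w _ => (hasDerivAt_update z a w).differentiableAt.differentiableWithinAt) hmem
      have han := hd.analyticOnNhd Metric.isOpen_ball
      have hball : ∀ t : ℝ, circleMap 0 (1 / 2) t ∈ Metric.ball (0 : ℂ) 1 := by
        intro t
        rw [mem_ball_zero_iff, norm_circleMap_zero]
        norm_num [abs_of_pos]
      have htend : Filter.Tendsto (circleMap 0 (1 / 2)) (𝓝[≠] Real.pi)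
          (𝓝[≠] (circleMap 0 (1 / 2) Real.pi)) :=
        (hasDerivAt_circleMap 0 (1 / 2) Real.pi).tendsto_nhdsNE (by simp)
      have hev : ∀ᶠ t in 𝓝[≠] Real.pi, F (Function.update z a (circleMap 0 (1 / 2) t)) = 0 := by
        have hI : Set.Ioo 0 (2 * Real.pi) ∈ 𝓝[≠] Real.pi :=
          mem_nhdsWithin_of_mem_nhds
            (Ioo_mem_nhds Real.pi_pos (by linarith [Real.pi_pos]))
        filter_upwards [hI] with t ht
        refine ih _ (hmem _ (hball t)) fun i hi => ?_
        rcases eq_or_ne i a with rfl | hia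
        · exact ⟨t, ht, by simp⟩
        · simpa [hia] using h i (by simp [hia, hi])
      have hz0 := han.eqOn_zero_of_preconnected_of_frequently_eq_zero
        (convex_ball (0 : ℂ) 1).isPreconnected (hball Real.pi)
        (htend.frequently hev.frequently) (x := z a) (by simpa using hz a)
      simpa using hz0
  ext z
  rw [← hFf]
  exact key Finset.univ z z.2 (by simp)

end HardyENorm

section BergmanENorm

variable {n : ℕ} {α : ℝ} {f g : polydisc n → ℂ}

theorem bergmanENorm_zero : bergmanENorm α (0 : polydisc n → ℂ) = 0 := by
  simp [bergmanENorm]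

theorem bergmanENorm_add_le (hf : IsHolomorphic f) (hg : IsHolomorphic g) :
    bergmanENorm α (f + g) ≤ bergmanENorm α f + bergmanENorm α g :=
  eLpNorm_add_le hf.continuous.aestronglyMeasurable hg.continuous.aestronglyMeasurable
    (by norm_num)

theorem bergmanENorm_smul (c : ℂ) : bergmanENorm α (c • f) = ‖c‖ₑ * bergmanENorm α f :=
  eLpNorm_const_smul c f 2 _

/-- The Bergman norm is definite on holomorphic functions. -/
theorem eq_zero_of_bergmanENorm_eq_zero (hf : IsHolomorphic f) (h0 : bergmanENorm α f = 0) :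
    f = 0 := by
  have hae : f =ᵐ[bergmanMeasure n α] 0 :=
    (eLpNorm_eq_zero_iff hf.continuous.aestronglyMeasurable (by norm_num)).1 h0
  have hmeas : Measurable fun z : polydisc n =>
      ENNReal.ofReal (∏ i, (1 - ‖z.1 i‖ ^ 2) ^ α) := by
    refine ENNReal.measurable_ofReal.comp (Finset.measurable_prod _ fun i _ => ?_)
    have : Measurable fun z : polydisc n => 1 - ‖z.1 i‖ ^ 2 :=
      (((measurable_pi_apply i).comp measurable_subtype_coe).norm.pow_const 2).const_sub 1
    exact this.pow_const α
  have hpos : ∀ z : polydisc n, ENNReal.ofReal (∏ i, (1 - ‖z.1 i‖ ^ 2) ^ α) ≠ 0 := by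
    intro z
    refine (ENNReal.ofReal_pos.2 (Finset.prod_pos fun i _ => Real.rpow_pos_of_pos ?_ _)).ne'
    nlinarith [z.2 i, norm_nonneg (z.1 i)]
  rw [bergmanMeasure, Filter.EventuallyEq, ae_withDensity_iff hmeas] at hae
  have hfin : volume (polydisc n) ≠ ∞ := by
    refine ne_top_of_le_ne_top (measure_closedBall_lt_top (x := (0 : Fin n → ℂ)) (r := 1)).ne
      (measure_mono fun z hz => ?_)
    rw [mem_closedBall_zero_iff, pi_norm_le_iff_of_nonneg zero_le_one]
    exact fun i => (hz i).le
  have hae' : f =ᵐ[(volume : Measure (Fin n → ℂ)).comap ((↑) : polydisc n → Fin n → ℂ)] 0 := by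
    have h2 := (Measure.absolutelyContinuous_smul (ENNReal.inv_ne_zero.2 hfin)).ae_le hae
    filter_upwards [h2] with z hz using hz (hpos z)
  by_contra hne
  obtain ⟨z, hz⟩ := Function.ne_iff.1 hne
  have hopen : IsOpen {t : polydisc n | f t ≠ 0} := isOpen_ne_fun hf.continuous continuous_const
  have hnull := ae_iff.1 hae'
  rw [(MeasurableEmbedding.subtype_coe (isOpen_polydisc n).measurableSet).comap_apply] at hnull
  exact (((isOpen_polydisc n).isOpenMap_subtype_val _ hopen).measure_pos volume
    ⟨z, z, hz, rfl⟩).ne' hnull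

end BergmanENorm

/-- The Hardy space `H²(𝔻ⁿ)` as a space of functions. -/
def hardySubmodule (n : ℕ) : Submodule ℂ (polydisc n → ℂ) where
  carrier := {f | IsHolomorphic f ∧ hardyENorm f < ∞}
  zero_mem' := ⟨IsHolomorphic.zero, by simp [hardyENorm_zero]⟩
  add_mem' hf hg := ⟨hf.1.add hg.1,
    (hardyENorm_add_le hf.1 hg.1).trans_lt (ENNReal.add_lt_top.2 ⟨hf.2, hg.2⟩)⟩
  smul_mem' c _ hf := ⟨hf.1.smul c, by
    rw [hardyENorm_smul]; exact ENNReal.mul_lt_top enorm_lt_top hf.2⟩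

/-- The weighted Bergman space `A²_α(𝔻ⁿ)` as a space of functions. -/
def bergmanSubmodule (n : ℕ) (α : ℝ) : Submodule ℂ (polydisc n → ℂ) where
  carrier := {f | IsHolomorphic f ∧ bergmanENorm α f < ∞}
  zero_mem' := ⟨IsHolomorphic.zero, by simp [bergmanENorm_zero]⟩
  add_mem' hf hg := ⟨hf.1.add hg.1,
    (bergmanENorm_add_le hf.1 hg.1).trans_lt (ENNReal.add_lt_top.2 ⟨hf.2, hg.2⟩)⟩
  smul_mem' c _ hf := ⟨hf.1.smul c, by
    rw [bergmanENorm_smul]; exact ENNReal.mul_lt_top enorm_lt_top hf.2⟩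

/-- The Hardy space `H²(𝔻ⁿ)`. A type of its own, so that its topology is the one of the Hardy norm
and not the topology of pointwise convergence. -/
def HardySpace (n : ℕ) : Type := hardySubmodule n

namespace HardySpace

variable {n : ℕ}

instance : AddCommGroup (HardySpace n) := inferInstanceAs (AddCommGroup (hardySubmodule n))

instance : Module ℂ (HardySpace n) := inferInstanceAs (Module ℂ (hardySubmodule n))

instance : CoeFun (HardySpace n) fun _ => polydisc n → ℂ := ⟨Subtype.val⟩

noncomputable instance : NormedAddCommGroup (HardySpace n) :=
  AddGroupNorm.toNormedAddCommGroup
    { toFun := fun f => (hardyENorm (f : polydisc n → ℂ)).toReal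
      map_zero' := by
        change (hardyENorm (0 : polydisc n → ℂ)).toReal = 0
        simp [hardyENorm_zero]
      add_le' := fun f g => by
        rw [← ENNReal.toReal_add f.2.2.ne g.2.2.ne]
        exact ENNReal.toReal_mono (ENNReal.add_lt_top.2 ⟨f.2.2, g.2.2⟩).ne
          (hardyENorm_add_le f.2.1 g.2.1)
      neg' := fun f => by
        have h := hardyENorm_smul (f := (f : polydisc n → ℂ)) (-1)
        rw [neg_one_smul, enorm_neg, enorm_one, one_mul] at h
        exact congrArg ENNReal.toReal h
      eq_zero_of_map_eq_zero' := fun f h => by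
        rcases (ENNReal.toReal_eq_zero_iff _).1 h with h | h
        · exact Subtype.ext (eq_zero_of_hardyENorm_eq_zero f.2.1 h)
        · exact absurd h f.2.2.ne }

theorem norm_def (f : HardySpace n) : ‖f‖ = (hardyENorm (f : polydisc n → ℂ)).toReal := rfl

noncomputable instance : NormedSpace ℂ (HardySpace n) where
  norm_smul_le c f := by
    have h := hardyENorm_smul (f := (f : polydisc n → ℂ)) c
    rw [norm_def, norm_def, ← toReal_enorm c, ← ENNReal.toReal_mul, ← h]
    exact le_rfl

end HardySpace

/-- The weighted Bergman space `A²_α(𝔻ⁿ)`, again a type of its own, with the topology of its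
norm. -/
def BergmanSpace (n : ℕ) (α : ℝ) : Type := bergmanSubmodule n α

namespace BergmanSpace

variable {n : ℕ} {α : ℝ}

instance : AddCommGroup (BergmanSpace n α) :=
  inferInstanceAs (AddCommGroup (bergmanSubmodule n α))

instance : Module ℂ (BergmanSpace n α) := inferInstanceAs (Module ℂ (bergmanSubmodule n α))

instance : CoeFun (BergmanSpace n α) fun _ => polydisc n → ℂ := ⟨Subtype.val⟩

noncomputable instance : NormedAddCommGroup (BergmanSpace n α) :=
  AddGroupNorm.toNormedAddCommGroup
    { toFun := fun f => (bergmanENorm α (f : polydisc n → ℂ)).toReal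
      map_zero' := by
        change (bergmanENorm α (0 : polydisc n → ℂ)).toReal = 0
        simp [bergmanENorm_zero]
      add_le' := fun f g => by
        rw [← ENNReal.toReal_add f.2.2.ne g.2.2.ne]
        exact ENNReal.toReal_mono (ENNReal.add_lt_top.2 ⟨f.2.2, g.2.2⟩).ne
          (bergmanENorm_add_le f.2.1 g.2.1)
      neg' := fun f => by
        have h := bergmanENorm_smul (α := α) (f := (f : polydisc n → ℂ)) (-1)
        rw [neg_one_smul, enorm_neg, enorm_one, one_mul] at h
        exact congrArg ENNReal.toReal h
      eq_zero_of_map_eq_zero' := fun f h => by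
        rcases (ENNReal.toReal_eq_zero_iff _).1 h with h | h
        · exact Subtype.ext (eq_zero_of_bergmanENorm_eq_zero f.2.1 h)
        · exact absurd h f.2.2.ne }

theorem norm_def (f : BergmanSpace n α) :
    ‖f‖ = (bergmanENorm α (f : polydisc n → ℂ)).toReal := rfl

noncomputable instance : NormedSpace ℂ (BergmanSpace n α) where
  norm_smul_le c f := by
    have h := bergmanENorm_smul (α := α) (f := (f : polydisc n → ℂ)) c
    rw [norm_def, norm_def, ← toReal_enorm c, ← ENNReal.toReal_mul, ← h]
    exact le_rfl

end BergmanSpace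

/-! Test C on the kernel k = `productKernel s w` with pole w = φ(z), where s = 1 for Hardy and s = α
+ 2 for Bergman. Put P = ∏ (1 - |zᵢ|²)^s, Q = ∏ (1 - |φᵢ(z)|²)^s, and K = 1 or K = `bergmanMass n
α`. Two sharp estimates suffice: K P |f(z)|² ≤ ‖f‖² for all f (`enorm_sq_le_hardyENorm_sq`,
`enorm_sq_le_bergmanENorm_sq`) and ‖k‖² ≤ K/Q (`hardyENorm_productKernel_sq_le`,
`bergmanENorm_productKernel_sq_le`). As (C k)(z) = k(w) has modulus 1/Q, they give K P/Q² ≤ ‖C k‖² ≤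
‖C‖² K/Q, hence P/Q ≤ ‖C‖² (`div_le_opNorm_sq`). No inner product, adjoint or completeness enters.

Kernel and measure are products, so both estimates come from one variable: point values by iteration
(`prod_mul_enorm_sq_le_lintegral_pi`), kernel norms by Tonelli. On a circle both one-variable facts
are Cauchy's formula for a well-chosen function. On the weighted disc the point estimate holds at 0
by rotation invariance and is carried to w by the involution exchanging 0 and w, which also makes
the kernel integral constant. -/

/-! ### Integration against product measures. -/

section PiMeasure

variable {ι X : Type*} [Fintype ι] [MeasurableSpace X]

/-- Tonelli's theorem for a product of functions of one coordinate each. -/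
theorem lintegral_pi_prod (μ : Measure X) [SigmaFinite μ] {g : ι → X → ℝ≥0∞}
    (hg : ∀ i, Measurable (g i)) :
    ∫⁻ x, ∏ i, g i (x i) ∂(Measure.pi fun _ : ι => μ) = ∏ i, ∫⁻ t, g i t ∂μ := by
  classical
  have hm : Measurable fun x : ι → X => ∏ i, g i (x i) :=
    Finset.measurable_prod _ fun i _ => (hg i).comp (measurable_pi_apply i)
  -- Induction on the set of coordinates already integrated out; the others stay frozen at z.
  have key : ∀ (s : Finset ι) (z : ι → X),
      lmarginal (fun _ => μ) s (fun x : ι → X => ∏ i, g i (x i)) z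
        = (∏ i ∈ s, ∫⁻ t, g i t ∂μ) * ∏ i ∈ sᶜ, g i (z i) := by
    intro s
    induction s using Finset.induction_on with
    | empty => intro z; simp
    | insert a s ha ih =>
      intro z
      rw [lmarginal_insert _ hm ha]
      have hs : sᶜ = insert a (insert a s)ᶜ := by
        ext j; by_cases hj : j = a <;> simp [hj, ha]
      have h1 : ∀ t, lmarginal (fun _ => μ) s (fun x : ι → X => ∏ i, g i (x i))
          (Function.update z a t) = g a t * ((∏ i ∈ s, ∫⁻ t, g i t ∂μ)
            * ∏ i ∈ (insert a s)ᶜ, g i (z i)) := by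
        intro t
        have h2 : ∏ i ∈ (insert a s)ᶜ, g i (Function.update z a t i)
            = ∏ i ∈ (insert a s)ᶜ, g i (z i) := by
          refine Finset.prod_congr rfl fun j hj => ?_
          rw [Function.update_of_ne]
          rintro rfl
          simp at hj
        rw [ih, hs, Finset.prod_insert (by simp), Function.update_self, h2]
        ring
      simp_rw [h1]
      rw [lintegral_mul_const _ (hg a), Finset.prod_insert ha, mul_assoc]
  -- The marginal needs a base point; without one, X is empty, ι is not, and both sides vanish.
  rcases isEmpty_or_nonempty (ι → X) with h | ⟨⟨z⟩⟩
  · obtain ⟨i, hi⟩ : ∃ i : ι, IsEmpty X := by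
      by_contra! hne
      exact h.elim fun i => (hne i).some
    rw [lintegral_of_isEmpty, Finset.prod_eq_zero (Finset.mem_univ i) (lintegral_of_isEmpty _ _)]
  · rw [lintegral_eq_lmarginal_univ z, key]
    simp

/-- A product of measures with densities is the product measure with the product density. -/
theorem pi_withDensity (μ : Measure X) [SigmaFinite μ] {ρ : X → ℝ≥0∞} (hρ : Measurable ρ)
    [SigmaFinite (μ.withDensity ρ)] :
    Measure.pi (fun _ : ι => μ.withDensity ρ)
      = (Measure.pi fun _ : ι => μ).withDensity fun x => ∏ i, ρ (x i) := by
  refine Measure.pi_eq fun s hs => ?_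
  rw [withDensity_apply _ (MeasurableSet.univ_pi hs), ← lintegral_indicator
    (MeasurableSet.univ_pi hs)]
  have h1 : (Set.univ.pi s).indicator (fun x : ι → X => ∏ i, ρ (x i))
      = fun x => ∏ i, (s i).indicator ρ (x i) := by
    ext x
    by_cases hx : x ∈ Set.univ.pi s
    · rw [Set.indicator_of_mem hx]
      exact Finset.prod_congr rfl fun i _ => (Set.indicator_of_mem (hx i trivial) _).symm
    · rw [Set.indicator_of_notMem hx]
      simp only [Set.mem_pi, Set.mem_univ, true_imp_iff, not_forall] at hx
      obtain ⟨i, hi⟩ := hx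
      exact (Finset.prod_eq_zero (Finset.mem_univ i) (Set.indicator_of_notMem hi _)).symm
  rw [h1, lintegral_pi_prod μ fun i => hρ.indicator (hs i)]
  exact Finset.prod_congr rfl fun i _ => by
    rw [lintegral_indicator (hs i), withDensity_apply _ (hs i)]

end PiMeasure

/-! ### From the disc to the polydisc, one coordinate at a time. -/

theorem mem_polydisc_update {n : ℕ} {z : Fin n → ℂ} (hz : z ∈ polydisc n) (i : Fin n) {w : ℂ}
    (hw : w ∈ Metric.ball (0 : ℂ) 1) : Function.update z i w ∈ polydisc n := by
  intro j
  rcases eq_or_ne j i with rfl | hj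
  · simpa using hw
  · simpa [hj] using hz j

theorem measurable_indicator_enorm_sq {n : ℕ} {F : (Fin n → ℂ) → ℂ}
    (hF : ContinuousOn F (polydisc n)) :
    Measurable ((polydisc n).indicator fun z => ‖F z‖ₑ ^ 2) := by
  classical
  rw [← Set.piecewise_eq_indicator]
  exact ContinuousOn.measurable_piecewise ((ENNReal.continuous_pow 2).comp_continuousOn hF.enorm)
    continuousOn_const
    (isOpen_polydisc n).measurableSet

/-- A weighted mean value inequality in the disc iterates to the polydisc. -/
theorem prod_mul_enorm_sq_le_lintegral_pi {n : ℕ} (μ : Measure ℂ) [SigmaFinite μ]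
    (hμ : ∀ᵐ w ∂μ, w ∈ Metric.ball (0 : ℂ) 1) {c : ℂ → ℝ≥0∞}
    (hc : ∀ G : ℂ → ℂ, DifferentiableOn ℂ G (Metric.ball 0 1) → ∀ a ∈ Metric.ball (0 : ℂ) 1,
      c a * ‖G a‖ₑ ^ 2 ≤ ∫⁻ w, ‖G w‖ₑ ^ 2 ∂μ)
    {F : (Fin n → ℂ) → ℂ} (hF : DifferentiableOn ℂ F (polydisc n)) {z : Fin n → ℂ}
    (hz : z ∈ polydisc n) :
    (∏ i, c (z i)) * ‖F z‖ₑ ^ 2 ≤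
      ∫⁻ x, (polydisc n).indicator (fun x => ‖F x‖ₑ ^ 2) x ∂(Measure.pi fun _ => μ) := by
  set u := (polydisc n).indicator fun x => ‖F x‖ₑ ^ 2 with hu
  have hum : Measurable u := measurable_indicator_enorm_sq hF.continuousOn
  -- The claim is made for all z because the induction step uses it at points with one coordinate
  -- moved.
  have key : ∀ (s : Finset (Fin n)), ∀ z ∈ polydisc n,
      (∏ i ∈ s, c (z i)) * ‖F z‖ₑ ^ 2 ≤ lmarginal (fun _ => μ) s u z := by
    intro s
    induction s using Finset.induction_on with
    | empty => intro z hz; simp [hu, hz]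
    | insert a s ha ih =>
      intro z hz
      rw [lmarginal_insert _ hum ha, Finset.prod_insert ha]
      have hd : DifferentiableOn ℂ (fun w => F (Function.update z a w)) (Metric.ball 0 1) :=
        hF.comp (fun w _ => (hasDerivAt_update z a w).differentiableAt.differentiableWithinAt)
          fun w hw => mem_polydisc_update hz a hw
      have h1 := hc _ hd (z a) (by simpa using hz a)
      rw [Function.update_eq_self] at h1
      calc c (z a) * (∏ i ∈ s, c (z i)) * ‖F z‖ₑ ^ 2
          = (∏ i ∈ s, c (z i)) * (c (z a) * ‖F z‖ₑ ^ 2) := by ring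
        _ ≤ (∏ i ∈ s, c (z i)) * ∫⁻ w, ‖F (Function.update z a w)‖ₑ ^ 2 ∂μ := by gcongr
        _ ≤ ∫⁻ w, (∏ i ∈ s, c (z i)) * ‖F (Function.update z a w)‖ₑ ^ 2 ∂μ :=
          lintegral_const_mul_le _ _
        _ ≤ _ := by
          refine lintegral_mono_ae ?_
          filter_upwards [hμ] with w hw
          refine le_trans (le_of_eq ?_) (ih _ (mem_polydisc_update hz a hw))
          congr 1
          refine Finset.prod_congr rfl fun j hj => ?_
          rw [Function.update_of_ne]
          rintro rfl
          exact ha hj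
  rw [lintegral_eq_lmarginal_univ z]
  exact key _ z hz

/-! ### Mean squares over circles. -/

open ComplexConjugate in
theorem one_sub_conj_mul_ne_zero {a z : ℂ} (h : ‖a‖ * ‖z‖ < 1) : 1 - conj a * z ≠ 0 := by
  intro h0
  have h1 : ‖conj a * z‖ = 1 := by rw [← sub_eq_zero.1 h0, norm_one]
  rw [norm_mul, Complex.norm_conj] at h1
  exact h.ne h1

theorem circleAverage_eq_integral_angleMeasure {E : Type*} [NormedAddCommGroup E]
    [NormedSpace ℝ E] (f : ℂ → E) (r : ℝ) :
    Real.circleAverage f 0 r = ∫ θ, f (circleMap 0 r θ) ∂angleMeasure := by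
  rw [Real.circleAverage_def, angleMeasure, integral_smul_measure,
    intervalIntegral.integral_of_le Real.two_pi_pos.le, ENNReal.toReal_inv,
    ENNReal.toReal_ofReal Real.two_pi_pos.le]

open ComplexConjugate in
/-- The sharp bound of a point value by the mean square over a circle. -/
theorem enorm_sq_le_lintegral_circle {r : ℝ} (hr : 0 < r) {F : ℂ → ℂ}
    (hF : DifferentiableOn ℂ F (Metric.closedBall 0 r)) {a : ℂ} (ha : ‖a‖ < r) :
    ENNReal.ofReal (1 - ‖a‖ ^ 2 / r ^ 2) * ‖F a‖ₑ ^ 2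
      ≤ ∫⁻ θ, ‖F (circleMap 0 r θ)‖ₑ ^ 2 ∂angleMeasure := by
  have hrc : (r : ℂ) ≠ 0 := by exact_mod_cast hr.ne'
  -- The extra factor equals 1 - |a|²/r² at a, and |ζ (1 - āζ/r²)| = |ζ - a| when |ζ| = r, so the
  -- Cauchy integrand for H at a has modulus exactly |F|².
  set H : ℂ → ℂ := fun z => F z ^ 2 * (1 - conj a * z / r ^ 2) with hH
  have hHd : DiffContOnCl ℂ H (Metric.ball 0 |r|) := by
    rw [abs_of_pos hr]
    apply DifferentiableOn.diffContOnCl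
    rw [closure_ball _ hr.ne']
    exact (hF.pow 2).mul (by fun_prop)
  have h1 := hHd.circleAverage_smul_div (c := 0) (R := r) (w := a)
    (by simpa [abs_of_pos hr] using ha)
  rw [circleAverage_eq_integral_angleMeasure] at h1
  have h2 : ‖H a‖ₑ = ENNReal.ofReal (1 - ‖a‖ ^ 2 / r ^ 2) * ‖F a‖ₑ ^ 2 := by
    have h3 : H a = F a ^ 2 * ((1 - ‖a‖ ^ 2 / r ^ 2 : ℝ) : ℂ) := by
      simp only [hH, Complex.conj_mul']
      push_cast
      ring
    have h4 : 0 ≤ 1 - ‖a‖ ^ 2 / r ^ 2 := by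
      rw [sub_nonneg, div_le_one (by positivity)]
      gcongr
    rw [h3, enorm_mul, enorm_pow, mul_comm, ← ofReal_norm (((_ : ℝ) : ℂ)),
      Complex.norm_of_nonneg h4]
  rw [← h2, ← h1]
  refine (enorm_integral_le_lintegral_enorm _).trans (lintegral_mono fun θ => le_of_eq ?_)
  set ζ := circleMap 0 r θ with hζ
  have hζn : ‖ζ‖ = r := by rw [hζ, norm_circleMap_zero, abs_of_pos hr]
  have hζ0 : ζ ≠ 0 := by rw [← norm_pos_iff, hζn]; exact hr
  have hne : ζ - a ≠ 0 := by
    intro h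
    rw [sub_eq_zero.1 h] at hζn
    exact ha.ne hζn
  have h5 : conj ζ * ζ = r ^ 2 := by rw [Complex.conj_mul', hζn]
  have h6 : ‖ζ * (1 - conj a * ζ / r ^ 2)‖ = ‖ζ - a‖ := by
    have h7 : 1 - conj a * ζ / r ^ 2 = ζ * conj (ζ - a) / r ^ 2 := by
      rw [map_sub]
      field_simp
      linear_combination -h5
    rw [h7, norm_mul, norm_div, norm_mul, Complex.norm_conj, norm_pow, Complex.norm_real,
      Real.norm_of_nonneg hr.le, hζn]
    field_simp
  have h8 : ((ζ - 0) / (ζ - a)) • H ζ = F ζ ^ 2 * (ζ * (1 - conj a * ζ / r ^ 2) / (ζ - a)) := by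
    simp only [hH, smul_eq_mul, sub_zero]
    ring
  rw [h8, enorm_mul, enorm_pow, ← ofReal_norm (_ / _), norm_div, h6,
    div_self (norm_ne_zero_iff.2 hne), ENNReal.ofReal_one, mul_one]

open ComplexConjugate in
/-- The mean square of the Szegő kernel over a circle. -/
theorem lintegral_circle_szego {r : ℝ} (hr : 0 < r) (hr1 : r < 1) {w : ℂ} (hw : ‖w‖ < 1) :
    ∫⁻ θ, ‖(1 - conj w * circleMap 0 r θ)⁻¹‖ₑ ^ 2 ∂angleMeasure
      = ENNReal.ofReal ((1 - r ^ 2 * ‖w‖ ^ 2)⁻¹) := by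
  have hpos : 0 < 1 - r ^ 2 * ‖w‖ ^ 2 := by
    have : r * ‖w‖ < 1 := mul_lt_one_of_nonneg_of_lt_one_left hr.le hr1 hw.le
    have h0 : 0 ≤ r * ‖w‖ := by positivity
    nlinarith
  have hmul : ∀ z : ℂ, ‖z‖ ≤ r → ‖w‖ * ‖z‖ < 1 := fun z hz =>
    mul_lt_one_of_nonneg_of_lt_one_left (norm_nonneg _) hw (hz.trans hr1.le)
  have hHd : DiffContOnCl ℂ (fun z => (1 - conj w * z)⁻¹) (Metric.ball 0 |r|) := by
    rw [abs_of_pos hr]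
    apply DifferentiableOn.diffContOnCl
    rw [closure_ball _ hr.ne']
    intro z hz
    refine DifferentiableAt.differentiableWithinAt (DifferentiableAt.inv (by fun_prop) ?_)
    exact one_sub_conj_mul_ne_zero (hmul z (by simpa using hz))
  -- On |ζ| = r the conjugate of the kernel is ζ/(ζ - r²w), so its mean square is the Cauchy
  -- integral of the kernel itself at the point r²w.
  have h1 := hHd.circleAverage_smul_div (c := 0) (R := r) (w := r ^ 2 * w) (by
    rw [abs_of_pos hr, mem_ball_zero_iff, norm_mul, norm_pow, Complex.norm_real, Real.norm_of_nonneg hr.le]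
    nlinarith [norm_nonneg w, mul_pos hr hr])
  rw [circleAverage_eq_integral_angleMeasure] at h1
  have h2 : ∀ θ, ((circleMap 0 r θ - 0) / (circleMap 0 r θ - r ^ 2 * w)) •
      (1 - conj w * circleMap 0 r θ)⁻¹
        = ((‖(1 - conj w * circleMap 0 r θ)⁻¹‖ ^ 2 : ℝ) : ℂ) := by
    intro θ
    set ζ := circleMap 0 r θ with hζ
    have hζn : ‖ζ‖ = r := by rw [hζ, norm_circleMap_zero, abs_of_pos hr]
    have hζ0 : ζ ≠ 0 := by rw [← norm_pos_iff, hζn]; exact hr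
    have h5 : conj ζ * ζ = r ^ 2 := by rw [Complex.conj_mul', hζn]
    have h6 : ζ - r ^ 2 * w = ζ * conj (1 - conj w * ζ) := by
      simp only [map_sub, map_mul, map_one, Complex.conj_conj]
      linear_combination w * h5
    have h7 : conj (1 - conj w * ζ) ≠ 0 :=
      (map_ne_zero _).2 (one_sub_conj_mul_ne_zero (hmul ζ hζn.le))
    rw [sub_zero, h6, Complex.ofReal_pow, ← Complex.conj_mul', map_inv₀, smul_eq_mul,
      div_mul_cancel_left₀ hζ0]
  simp_rw [h2] at h1
  rw [integral_complex_ofReal] at h1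
  have h3 : (1 - conj w * (r ^ 2 * w))⁻¹ = (((1 - r ^ 2 * ‖w‖ ^ 2)⁻¹ : ℝ) : ℂ) := by
    push_cast
    rw [← Complex.conj_mul']
    ring
  rw [h3, Complex.ofReal_inj] at h1
  -- A non-integrable function would have integral 0, while the value found is positive.
  have hint : Integrable (fun θ => ‖(1 - conj w * circleMap 0 r θ)⁻¹‖ ^ 2) angleMeasure := by
    by_contra hn
    rw [integral_undef hn] at h1
    exact (inv_pos.2 hpos).ne h1
  rw [← h1, ofReal_integral_eq_lintegral_ofReal hint (.of_forall fun θ => by positivity)]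
  refine lintegral_congr fun θ => ?_
  rw [ENNReal.ofReal_pow (norm_nonneg _), ofReal_norm]

/-! ### The weighted area measure on the disc. -/

/-- The weighted area measure `(1 - |z|²)^α dA` on the unit disc, not normalized. -/
noncomputable def discMeasure (α : ℝ) : Measure ℂ :=
  (volume.restrict (Metric.ball (0 : ℂ) 1)).withDensity fun z => ENNReal.ofReal ((1 - ‖z‖ ^ 2) ^ α)

theorem measurable_discWeight (α : ℝ) :
    Measurable fun z : ℂ => ENNReal.ofReal ((1 - ‖z‖ ^ 2) ^ α) :=
  ENNReal.measurable_ofReal.comp (((measurable_norm.pow_const 2).const_sub 1).pow_const α)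

theorem lintegral_discMeasure (α : ℝ) (f : ℂ → ℝ≥0∞) :
    ∫⁻ z, f z ∂discMeasure α
      = ∫⁻ z in Metric.ball (0 : ℂ) 1, ENNReal.ofReal ((1 - ‖z‖ ^ 2) ^ α) * f z :=
  lintegral_withDensity_eq_lintegral_mul_non_measurable _ (measurable_discWeight α)
    (.of_forall fun _ => ENNReal.ofReal_lt_top) f

theorem ae_discMeasure_mem_ball (α : ℝ) : ∀ᵐ w ∂discMeasure α, w ∈ Metric.ball (0 : ℂ) 1 :=
  (withDensity_absolutelyContinuous _ _).ae_le (ae_restrict_mem measurableSet_ball)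

theorem one_sub_norm_sq_pos {z : ℂ} (hz : ‖z‖ < 1) : 0 < 1 - ‖z‖ ^ 2 := by
  nlinarith [norm_nonneg z]

theorem discMeasure_univ_ne_zero (α : ℝ) : discMeasure α Set.univ ≠ 0 := by
  rw [← lintegral_one, lintegral_discMeasure]
  simp_rw [mul_one]
  rw [← pos_iff_ne_zero, setLIntegral_pos_iff (measurable_discWeight α)]
  refine lt_of_lt_of_le (Metric.measure_ball_pos volume (0 : ℂ) one_pos) (measure_mono ?_)
  intro z hz
  refine ⟨?_, hz⟩
  rw [Function.mem_support]
  exact (ENNReal.ofReal_pos.2 (Real.rpow_pos_of_pos (one_sub_norm_sq_pos (by simpa using hz)) _)).ne'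

theorem integrableOn_discWeight {α : ℝ} (hα : -1 < α) :
    IntegrableOn (fun z : ℂ => (1 - ‖z‖ ^ 2) ^ α) (Metric.ball 0 1) := by
  rw [integrableOn_fun_norm_addHaar volume (f := fun t : ℝ => (1 - t ^ 2) ^ α)]
  -- Polar coordinates leave y (1 - y²)^α = y (1 + y)^α (1 - y)^α; only the last factor can be
  -- singular on [0, 1], and it is integrable because α > -1.
  have h1 : IntervalIntegrable (fun y : ℝ => y * (1 + y) ^ α * (1 - y) ^ α) volume 0 1 := by
    have h2 := ((intervalIntegral.intervalIntegrable_rpow' hα (a := 0) (b := 1)).comp_sub_left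
      1).symm
    simp only [sub_self, sub_zero] at h2
    refine h2.continuousOn_mul ?_
    refine continuousOn_id.mul (ContinuousOn.rpow_const (by fun_prop) fun y hy => Or.inl ?_)
    rw [Set.uIcc_of_le zero_le_one] at hy
    linarith [hy.1]
  have h3 := (intervalIntegrable_iff_integrableOn_Ioo_of_le zero_le_one).1 h1
  refine h3.congr_fun (fun y hy => ?_) measurableSet_Ioo
  simp only [Complex.finrank_real_complex, Nat.add_one_sub_one, pow_one, smul_eq_mul]
  rw [mul_assoc, ← Real.mul_rpow (by linarith [hy.1]) (by linarith [hy.2])]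
  ring_nf

theorem discMeasure_univ_ne_top {α : ℝ} (hα : -1 < α) : discMeasure α Set.univ ≠ ∞ := by
  rw [← lintegral_one, lintegral_discMeasure]
  simp_rw [mul_one]
  exact (integrableOn_discWeight hα).setLIntegral_lt_top.ne

theorem isFiniteMeasure_discMeasure {α : ℝ} (hα : -1 < α) : IsFiniteMeasure (discMeasure α) :=
  ⟨(discMeasure_univ_ne_top hα).lt_top⟩

/-- The mean value inequality at the centre of the disc for a radial weight. -/
theorem enorm_sq_zero_le_lintegral_discMeasure (α : ℝ) {G : ℂ → ℂ}
    (hG : DifferentiableOn ℂ G (Metric.ball 0 1)) :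
    discMeasure α Set.univ * ‖G 0‖ₑ ^ 2 ≤ ∫⁻ w, ‖G w‖ₑ ^ 2 ∂discMeasure α := by
  classical
  set ρ : ℂ → ℝ≥0∞ := fun z => ENNReal.ofReal ((1 - ‖z‖ ^ 2) ^ α)
  -- Extension by zero makes rotation invariance a statement about Lebesgue measure on the whole
  -- plane.
  set H : ℂ → ℝ≥0∞ := (Metric.ball (0 : ℂ) 1).indicator fun z => ρ z * ‖G z‖ₑ ^ 2 with hH
  have hHm : Measurable H := by
    have h1 : Measurable ((Metric.ball (0 : ℂ) 1).indicator fun z => ‖G z‖ₑ ^ 2) := by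
      rw [← Set.piecewise_eq_indicator]
      exact ContinuousOn.measurable_piecewise
        ((ENNReal.continuous_pow 2).comp_continuousOn hG.continuousOn.enorm) continuousOn_const
        measurableSet_ball
    have h2 : H = fun z => ρ z * (Metric.ball (0 : ℂ) 1).indicator (fun z => ‖G z‖ₑ ^ 2) z := by
      ext z
      by_cases hz : z ∈ Metric.ball (0 : ℂ) 1 <;> simp [hH, hz]
    rw [h2]
    exact (measurable_discWeight α).mul h1
  have hcirc : ∀ θ, ‖circleMap 0 1 θ‖ = 1 := by simp
  have hrot : ∀ θ : ℝ, ∫⁻ z, H (circleMap 0 1 θ * z) = ∫⁻ z, H z := by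
    intro θ
    have h1 := (rotation (Circle.exp θ)).measurePreserving.lintegral_comp hHm
    rw [← h1]
    refine lintegral_congr fun z => ?_
    simp [rotation_apply, circleMap]
  -- For fixed z the weight is constant along the rotations of z, and v ↦ G(vz) obeys the circle
  -- estimate at its centre. Integrating over z and swapping the integrals gives the claim.
  have hav : ∀ z, (Metric.ball (0 : ℂ) 1).indicator ρ z * ‖G 0‖ₑ ^ 2
      ≤ ∫⁻ θ, H (circleMap 0 1 θ * z) ∂angleMeasure := by
    intro z
    by_cases hz : z ∈ Metric.ball (0 : ℂ) 1
    · have hz1 : ‖z‖ < 1 := by simpa using hz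
      have hmem : ∀ v : ℂ, ‖v‖ ≤ 1 → v * z ∈ Metric.ball (0 : ℂ) 1 := fun v hv => by
        rw [mem_ball_zero_iff, norm_mul]
        exact mul_lt_one_of_nonneg_of_lt_one_right hv (norm_nonneg _) hz1
      have hd : DifferentiableOn ℂ (fun v => G (v * z)) (Metric.closedBall 0 1) :=
        hG.comp (by fun_prop) fun v hv => hmem v (by simpa using hv)
      have h1 := enorm_sq_le_lintegral_circle one_pos hd (a := 0) (by simp)
      simp only [norm_zero, zero_mul, ne_eq, OfNat.ofNat_ne_zero, not_false_eq_true, zero_pow,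
        zero_div, sub_zero, ENNReal.ofReal_one, one_mul] at h1
      have h2 : ∀ θ, H (circleMap 0 1 θ * z) = ρ z * ‖G (circleMap 0 1 θ * z)‖ₑ ^ 2 := by
        intro θ
        rw [hH, Set.indicator_of_mem (hmem _ (hcirc θ).le)]
        simp only [ρ, norm_mul, hcirc, one_mul]
      simp_rw [h2]
      rw [Set.indicator_of_mem hz, lintegral_const_mul' _ _ ENNReal.ofReal_ne_top]
      gcongr
    · simp [Set.indicator_of_notMem hz]
  calc discMeasure α Set.univ * ‖G 0‖ₑ ^ 2
      = ∫⁻ z, (Metric.ball (0 : ℂ) 1).indicator ρ z * ‖G 0‖ₑ ^ 2 := by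
        rw [lintegral_mul_const _ ((measurable_discWeight α).indicator measurableSet_ball),
          lintegral_indicator measurableSet_ball, ← lintegral_one, lintegral_discMeasure]
        simp_rw [mul_one]
    _ ≤ ∫⁻ z : ℂ, ∫⁻ θ, H (circleMap 0 1 θ * z) ∂angleMeasure := lintegral_mono hav
    _ = ∫⁻ θ, (∫⁻ z : ℂ, H (circleMap 0 1 θ * z)) ∂angleMeasure := by
        refine lintegral_lintegral_swap (Measurable.aemeasurable ?_)
        refine hHm.comp ?_
        exact (((continuous_circleMap 0 1).comp continuous_snd).mul continuous_fst).measurable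
    _ = ∫⁻ w, ‖G w‖ₑ ^ 2 ∂discMeasure α := by
        simp_rw [hrot]
        rw [lintegral_const, measure_univ, mul_one, hH, lintegral_indicator measurableSet_ball,
          lintegral_discMeasure]

/-! ### Disc involution and sharp weighted estimates. -/

section DiscInvolution

open ComplexConjugate

/-- The involutive automorphism of the unit disc that exchanges `0` and `w`. -/
noncomputable def discInvolution (w u : ℂ) : ℂ := (w - u) / (1 - conj w * u)

variable {w u : ℂ}

theorem one_sub_conj_mul_ne_zero_of_lt (hw : ‖w‖ < 1) (hu : ‖u‖ < 1) : 1 - conj w * u ≠ 0 :=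
  one_sub_conj_mul_ne_zero (mul_lt_one_of_nonneg_of_lt_one_left (norm_nonneg _) hw hu.le)

/-- The involution inverts the kernel up to a constant; this is what makes the kernel integral
computable. -/
theorem one_sub_conj_mul_discInvolution (hw : ‖w‖ < 1) (hu : ‖u‖ < 1) :
    1 - conj w * discInvolution w u = ((1 - ‖w‖ ^ 2 : ℝ) : ℂ) / (1 - conj w * u) := by
  have h := one_sub_conj_mul_ne_zero_of_lt hw hu
  rw [discInvolution]
  push_cast
  rw [← Complex.conj_mul']
  field_simp
  ring

theorem one_sub_norm_sq_discInvolution (hw : ‖w‖ < 1) (hu : ‖u‖ < 1) :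
    1 - ‖discInvolution w u‖ ^ 2
      = (1 - ‖w‖ ^ 2) * (1 - ‖u‖ ^ 2) / ‖1 - conj w * u‖ ^ 2 := by
  have h := one_sub_conj_mul_ne_zero_of_lt hw hu
  have h0 : ‖1 - conj w * u‖ ^ 2 ≠ 0 := by simpa using h
  rw [discInvolution, norm_div, div_pow, eq_div_iff h0, sub_mul, div_mul_cancel₀ _ h0,
    ← Complex.ofReal_inj]
  push_cast
  simp only [← Complex.conj_mul', map_sub, map_mul, map_one, Complex.conj_conj]
  ring

theorem norm_discInvolution_lt (hw : ‖w‖ < 1) (hu : ‖u‖ < 1) : ‖discInvolution w u‖ < 1 := by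
  have h := one_sub_norm_sq_discInvolution hw hu
  have h1 : 0 < 1 - ‖discInvolution w u‖ ^ 2 := by
    rw [h]
    have := norm_pos_iff.2 (one_sub_conj_mul_ne_zero_of_lt hw hu)
    have := one_sub_norm_sq_pos hw
    have := one_sub_norm_sq_pos hu
    positivity
  nlinarith [norm_nonneg (discInvolution w u)]

theorem discInvolution_discInvolution (hw : ‖w‖ < 1) (hu : ‖u‖ < 1) :
    discInvolution w (discInvolution w u) = u := by
  have h := one_sub_conj_mul_ne_zero_of_lt hw hu
  have h0 : ((1 - ‖w‖ ^ 2 : ℝ) : ℂ) ≠ 0 := by exact_mod_cast (one_sub_norm_sq_pos hw).ne'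
  have h1 : w - discInvolution w u = ((1 - ‖w‖ ^ 2 : ℝ) : ℂ) * u / (1 - conj w * u) := by
    rw [discInvolution, eq_div_iff h, sub_mul, div_mul_cancel₀ _ h]
    push_cast
    rw [← Complex.conj_mul']
    ring
  rw [discInvolution, one_sub_conj_mul_discInvolution hw hu, h1, div_div_div_cancel_right₀ h,
    mul_div_cancel_left₀ _ h0]

theorem image_discInvolution (hw : ‖w‖ < 1) :
    discInvolution w '' Metric.ball 0 1 = Metric.ball 0 1 := by
  ext z
  simp only [Set.mem_image, mem_ball_zero_iff]
  exact ⟨fun ⟨u, hu, h⟩ => h ▸ norm_discInvolution_lt hw hu, fun hz =>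
    ⟨_, norm_discInvolution_lt hw hz, discInvolution_discInvolution hw hz⟩⟩

theorem hasDerivAt_discInvolution (hw : ‖w‖ < 1) (hu : ‖u‖ < 1) :
    HasDerivAt (discInvolution w)
      (-((1 - ‖w‖ ^ 2 : ℝ) : ℂ) / (1 - conj w * u) ^ 2) u := by
  have h := one_sub_conj_mul_ne_zero_of_lt hw hu
  have h1 : HasDerivAt (fun u => w - u) (-1) u := (hasDerivAt_id u).const_sub w
  have h2 : HasDerivAt (fun u => 1 - conj w * u) (-(conj w * 1)) u :=
    ((hasDerivAt_id u).const_mul _).const_sub 1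
  refine (h1.div h2 h).congr_deriv ?_
  push_cast
  rw [← Complex.conj_mul']
  congr 1
  ring

/-- The real determinant of a complex linear map is the norm from ℂ to ℝ of its complex determinant.
-/
theorem abs_det_restrictScalars_toSpanSingleton (c : ℂ) :
    |((ContinuousLinearMap.toSpanSingleton ℂ c).restrictScalars ℝ).det| = ‖c‖ ^ 2 := by
  have h : (((ContinuousLinearMap.toSpanSingleton ℂ c).restrictScalars ℝ : ℂ →L[ℝ] ℂ) : ℂ →ₗ[ℝ] ℂ)
      = (LinearMap.toSpanSingleton ℂ ℂ c).restrictScalars ℝ := rfl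
  rw [ContinuousLinearMap.det, h, LinearMap.det_restrictScalars, Algebra.norm_complex_apply,
    Complex.normSq_eq_norm_sq, abs_of_nonneg (by positivity)]
  simp

/-- The change of variables by the involution in the weighted area integral. -/
theorem lintegral_discMeasure_discInvolution (α : ℝ) (hw : ‖w‖ < 1) (f : ℂ → ℝ≥0∞) :
    ∫⁻ z, f z ∂discMeasure α = ENNReal.ofReal ((1 - ‖w‖ ^ 2) ^ (α + 2)) *
      ∫⁻ u, ENNReal.ofReal ((‖1 - conj w * u‖ ^ 2) ^ (-(α + 2))) * f (discInvolution w u)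
        ∂discMeasure α := by
  have hinj : Set.InjOn (discInvolution w) (Metric.ball 0 1) := fun a ha b hb hab => by
    rw [← discInvolution_discInvolution hw (mem_ball_zero_iff.1 ha), hab,
      discInvolution_discInvolution hw (mem_ball_zero_iff.1 hb)]
  rw [lintegral_discMeasure, lintegral_discMeasure, ← lintegral_const_mul' _ _ ENNReal.ofReal_ne_top]
  conv_lhs => rw [← image_discInvolution hw]
  rw [lintegral_image_eq_lintegral_abs_det_fderiv_mul volume measurableSet_ball
    (fun u hu => ((hasDerivAt_discInvolution hw
      (mem_ball_zero_iff.1 hu)).hasFDerivAt.restrictScalars ℝ).hasFDerivWithinAt) hinj]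
  refine setLIntegral_congr_fun measurableSet_ball fun u hu => ?_
  have hu1 : ‖u‖ < 1 := mem_ball_zero_iff.1 hu
  have hA := one_sub_norm_sq_pos hw
  have hB := one_sub_norm_sq_pos hu1
  have hN : 0 < ‖1 - conj w * u‖ := norm_pos_iff.2 (one_sub_conj_mul_ne_zero_of_lt hw hu1)
  rw [abs_det_restrictScalars_toSpanSingleton, one_sub_norm_sq_discInvolution hw hu1,
    ← mul_assoc, ← mul_assoc, ← mul_assoc, ← ENNReal.ofReal_mul (by positivity),
    ← ENNReal.ofReal_mul (by positivity), ← ENNReal.ofReal_mul (by positivity)]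
  congr 2
  -- The weight contributes the exponent α and the real Jacobian, the squared modulus of the
  -- derivative, contributes 2.
  rw [norm_div, norm_neg, Complex.norm_of_nonneg hA.le, norm_pow]
  set A := 1 - ‖w‖ ^ 2
  set B := 1 - ‖u‖ ^ 2
  set q := ‖1 - conj w * u‖ ^ 2 with hq
  have hq0 : 0 < q := by positivity
  rw [Real.div_rpow (by positivity) hq0.le, Real.mul_rpow hA.le hB.le, Real.rpow_neg hq0.le,
    Real.rpow_add hA, Real.rpow_add hq0, Real.rpow_two, Real.rpow_two]
  field_simp

theorem norm_cpow_sq (s : ℝ) (v : ℂ) : ‖v ^ (-(s : ℂ))‖ ^ 2 = (‖v‖ ^ 2) ^ (-s) := by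
  rw [← Complex.ofReal_neg, Complex.norm_cpow_real, ← Real.rpow_natCast, ← Real.rpow_natCast,
    ← Real.rpow_mul (norm_nonneg _), ← Real.rpow_mul (norm_nonneg _), mul_comm]

theorem enorm_cpow_sq (s : ℝ) (v : ℂ) :
    ‖v ^ (-(s : ℂ))‖ₑ ^ 2 = ENNReal.ofReal ((‖v‖ ^ 2) ^ (-s)) := by
  rw [← norm_cpow_sq, ENNReal.ofReal_pow (norm_nonneg _), ofReal_norm]

/-- The real part is positive, so the principal branch is holomorphic here even when the exponent α
+ 2 is not an integer. -/
theorem one_sub_conj_mul_mem_slitPlane (hw : ‖w‖ < 1) (hu : ‖u‖ < 1) :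
    1 - conj w * u ∈ Complex.slitPlane := by
  left
  have h1 : ‖conj w * u‖ < 1 := by
    rw [norm_mul, Complex.norm_conj]
    exact mul_lt_one_of_nonneg_of_lt_one_left (norm_nonneg _) hw hu.le
  have h2 := (Complex.re_le_norm (conj w * u)).trans_lt h1
  simp only [Complex.sub_re, Complex.one_re]
  linarith

theorem differentiableAt_one_sub_conj_mul_cpow (s : ℂ) (hw : ‖w‖ < 1) (hu : ‖u‖ < 1) :
    DifferentiableAt ℂ (fun u => (1 - conj w * u) ^ s) u :=
  DifferentiableAt.cpow (by fun_prop) (by fun_prop) (one_sub_conj_mul_mem_slitPlane hw hu)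

/-- The sharp bound of a point value by the weighted Bergman norm on the disc. -/
theorem enorm_sq_le_lintegral_discMeasure (α : ℝ) {G : ℂ → ℂ}
    (hG : DifferentiableOn ℂ G (Metric.ball 0 1)) (hw : ‖w‖ < 1) :
    discMeasure α Set.univ * ENNReal.ofReal ((1 - ‖w‖ ^ 2) ^ (α + 2)) * ‖G w‖ₑ ^ 2
      ≤ ∫⁻ z, ‖G z‖ₑ ^ 2 ∂discMeasure α := by
  rw [lintegral_discMeasure_discInvolution α hw, mul_comm (discMeasure α _), mul_assoc]
  gcongr
  -- The squared modulus of this function is the integrand produced by the change of variables, and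
  -- its value at 0 is G w; the estimate at the centre finishes.
  have hd : DifferentiableOn ℂ (fun u => (1 - conj w * u) ^ (-((α + 2 : ℝ) : ℂ)) *
      G (discInvolution w u)) (Metric.ball 0 1) := by
    refine DifferentiableOn.mul (fun u hu => (differentiableAt_one_sub_conj_mul_cpow _ hw
      (mem_ball_zero_iff.1 hu)).differentiableWithinAt) (hG.comp (fun u hu =>
      (hasDerivAt_discInvolution hw (mem_ball_zero_iff.1 hu)).differentiableAt.differentiableWithinAt)
      fun u hu => ?_)
    exact mem_ball_zero_iff.2 (norm_discInvolution_lt hw (mem_ball_zero_iff.1 hu))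
  have h := enorm_sq_zero_le_lintegral_discMeasure α hd
  simp only [mul_pow, enorm_mul, enorm_cpow_sq] at h
  simpa [discInvolution] using h

/-- The weighted Bergman norm on the disc of a power of the Szegő kernel. -/
theorem lintegral_discMeasure_kernel (α : ℝ) (hw : ‖w‖ < 1) :
    ∫⁻ z, ‖(1 - conj w * z) ^ (-((α + 2 : ℝ) : ℂ))‖ₑ ^ 2 ∂discMeasure α
      = discMeasure α Set.univ * ENNReal.ofReal ((1 - ‖w‖ ^ 2) ^ (-(α + 2))) := by
  have hA := one_sub_norm_sq_pos hw
  rw [lintegral_discMeasure_discInvolution α hw]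
  -- The Jacobian factor and the transformed kernel cancel in u, leaving a constant.
  have h1 : ∀ᵐ u ∂discMeasure α, ENNReal.ofReal ((‖1 - conj w * u‖ ^ 2) ^ (-(α + 2))) *
      ‖(1 - conj w * discInvolution w u) ^ (-((α + 2 : ℝ) : ℂ))‖ₑ ^ 2
        = ENNReal.ofReal (((1 - ‖w‖ ^ 2) ^ 2) ^ (-(α + 2))) := by
    filter_upwards [ae_discMeasure_mem_ball α] with u hu
    have hu1 : ‖u‖ < 1 := mem_ball_zero_iff.1 hu
    have hN : 0 < ‖1 - conj w * u‖ := norm_pos_iff.2 (one_sub_conj_mul_ne_zero_of_lt hw hu1)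
    rw [enorm_cpow_sq, one_sub_conj_mul_discInvolution hw hu1, norm_div,
      Complex.norm_of_nonneg hA.le, ← ENNReal.ofReal_mul (by positivity),
      ← Real.mul_rpow (by positivity) (by positivity)]
    congr 2
    field_simp
  rw [lintegral_congr_ae h1, lintegral_const, mul_comm (ENNReal.ofReal _) (discMeasure α _),
    mul_left_comm, ← ENNReal.ofReal_mul (by positivity)]
  congr 2
  set A := 1 - ‖w‖ ^ 2
  rw [sq A, Real.mul_rpow hA.le hA.le, ← mul_assoc, ← Real.rpow_add hA, add_neg_cancel,
    Real.rpow_zero, one_mul]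

end DiscInvolution

theorem eLpNorm_two_sq {X : Type*} [MeasurableSpace X] (μ : Measure X) (f : X → ℂ) :
    eLpNorm f 2 μ ^ 2 = ∫⁻ x, ‖f x‖ₑ ^ 2 ∂μ := by
  rw [eLpNorm_eq_lintegral_rpow_enorm_toReal two_ne_zero ENNReal.ofNat_ne_top, ← ENNReal.rpow_two,
    ← ENNReal.rpow_mul]
  simp

/-! ### The kernel of the polydisc. -/

section ProductKernel

open ComplexConjugate

variable {n : ℕ} {w z : Fin n → ℂ}

/-- The power `∏ (1 - w̄ᵢ zᵢ)^(-s)` of the Szegő kernel of the polydisc. -/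
noncomputable def productKernel (s : ℝ) (w z : Fin n → ℂ) : ℂ :=
  ∏ i, (1 - conj (w i) * z i) ^ (-(s : ℂ))

theorem differentiableOn_productKernel (s : ℝ) (hw : w ∈ polydisc n) :
    DifferentiableOn ℂ (productKernel s w) (polydisc n) := by
  intro z hz
  refine DifferentiableAt.differentiableWithinAt ?_
  have h : ∀ i, DifferentiableAt ℂ (fun z : Fin n → ℂ => (1 - conj (w i) * z i) ^ (-(s : ℂ))) z :=
    fun i => DifferentiableAt.cpow (by fun_prop) (by fun_prop)
      (one_sub_conj_mul_mem_slitPlane (hw i) (hz i))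
  exact (HasFDerivAt.finsetProd fun i _ => (h i).hasFDerivAt).differentiableAt

theorem isHolomorphic_productKernel (s : ℝ) (hw : w ∈ polydisc n) :
    IsHolomorphic fun z : polydisc n => productKernel s w z :=
  ⟨_, differentiableOn_productKernel s hw, fun _ => rfl⟩

theorem prod_rpow_one_sub_norm_sq_pos (s : ℝ) (hw : w ∈ polydisc n) :
    0 < ∏ i, (1 - ‖w i‖ ^ 2) ^ s :=
  Finset.prod_pos fun i _ => Real.rpow_pos_of_pos (one_sub_norm_sq_pos (hw i)) _

theorem norm_productKernel_self (s : ℝ) (hw : w ∈ polydisc n) :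
    ‖productKernel s w w‖ = (∏ i, (1 - ‖w i‖ ^ 2) ^ s)⁻¹ := by
  rw [productKernel, norm_prod, ← Finset.prod_inv_distrib]
  refine Finset.prod_congr rfl fun i _ => ?_
  have h := one_sub_norm_sq_pos (hw i)
  have h1 : 1 - conj (w i) * w i = ((1 - ‖w i‖ ^ 2 : ℝ) : ℂ) := by
    push_cast
    rw [Complex.conj_mul']
  rw [h1, ← Complex.ofReal_neg, Complex.norm_cpow_real, Complex.norm_of_nonneg h.le,
    Real.rpow_neg h.le]

/-- Only an upper bound on the kernel norm is needed, so the indicator is simply dropped before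
Tonelli. -/
theorem lintegral_pi_productKernel_le (s : ℝ) (w : Fin n → ℂ) (μ : Measure ℂ) [SigmaFinite μ] :
    ∫⁻ x, (polydisc n).indicator (fun x => ‖productKernel s w x‖ₑ ^ 2) x ∂(Measure.pi fun _ => μ)
      ≤ ∏ i, ∫⁻ t, ‖(1 - conj (w i) * t) ^ (-(s : ℂ))‖ₑ ^ 2 ∂μ := by
  rw [← lintegral_pi_prod]
  · refine lintegral_mono fun x => (Set.indicator_le_self _ _ _).trans (le_of_eq ?_)
    rw [productKernel, ← ofReal_norm, norm_prod, ENNReal.ofReal_prod_of_nonneg (by simp),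
      ← Finset.prod_pow]
    simp
  · intro i
    fun_prop

end ProductKernel

/-! ### Point values and kernel norm in the Hardy space. -/

section Hardy

variable {n : ℕ} {f : polydisc n → ℂ}

theorem isProbabilityMeasure_map_circleMap (r : ℝ) :
    IsProbabilityMeasure (angleMeasure.map (circleMap 0 r)) :=
  Measure.isProbabilityMeasure_map (continuous_circleMap 0 r).aemeasurable

/-- Rewrites the torus mean over a product of measures on ℂ, the form the iteration needs; the
indicator hides F outside the polydisc, where nothing is known of it. -/
theorem eLpNorm_torusPoint_sq (r : Set.Ico (0 : ℝ) 1) {F : (Fin n → ℂ) → ℂ}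
    (hF : ContinuousOn F (polydisc n)) (h : ∀ z : polydisc n, F z = f z) :
    eLpNorm (fun θ => f (torusPoint r θ)) 2 (torusMeasure n) ^ 2
      = ∫⁻ x, (polydisc n).indicator (fun x => ‖F x‖ₑ ^ 2) x
        ∂(Measure.pi fun _ => angleMeasure.map (circleMap 0 r)) := by
  have := isProbabilityMeasure_map_circleMap r
  rw [eLpNorm_two_sq, torusMeasure,
    ← Measure.pi_map_pi fun _ => (continuous_circleMap 0 (r : ℝ)).aemeasurable,
    lintegral_map (measurable_indicator_enorm_sq hF)
      (by fun_prop)]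
  refine lintegral_congr fun θ => ?_
  rw [← h]
  exact (Set.indicator_of_mem (torusPoint r θ).2 fun x => ‖F x‖ₑ ^ 2).symm

theorem hardyENorm_sq (f : polydisc n → ℂ) : hardyENorm f ^ 2
    = ⨆ r : Set.Ico (0 : ℝ) 1, eLpNorm (fun θ => f (torusPoint r θ)) 2 (torusMeasure n) ^ 2 := by
  simp_rw [← ENNReal.rpow_two]
  exact (ENNReal.monotone_rpow_of_nonneg zero_le_two).map_iSup_of_continuousAt
    ENNReal.continuous_rpow_const.continuousAt (by simp)

/-- The sharp bound of a point value by the Hardy norm. -/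
theorem enorm_sq_le_hardyENorm_sq (hf : IsHolomorphic f) (z : polydisc n) :
    ENNReal.ofReal (∏ i, (1 - ‖z.1 i‖ ^ 2)) * ‖f z‖ₑ ^ 2 ≤ hardyENorm f ^ 2 := by
  obtain ⟨F, hF, h⟩ := hf
  have h1 : ∀ r : ℝ, 0 < r → r < 1 → (∀ i, ‖z.1 i‖ < r) →
      ENNReal.ofReal (∏ i, (1 - ‖z.1 i‖ ^ 2 / r ^ 2)) * ‖f z‖ₑ ^ 2 ≤ hardyENorm f ^ 2 := by
    intro r hr hr1 hz
    have := isProbabilityMeasure_map_circleMap r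
    have hmem : ∀ θ, circleMap 0 r θ ∈ Metric.ball (0 : ℂ) 1 := fun θ => by
      rwa [mem_ball_zero_iff, norm_circleMap_zero, abs_of_pos hr]
    have hμ : ∀ᵐ w ∂angleMeasure.map (circleMap 0 r), w ∈ Metric.ball (0 : ℂ) 1 :=
      (ae_map_iff (continuous_circleMap 0 r).aemeasurable measurableSet_ball).2 (.of_forall hmem)
    have h2 := prod_mul_enorm_sq_le_lintegral_pi (angleMeasure.map (circleMap 0 r)) hμ
      (c := fun a => ENNReal.ofReal (1 - ‖a‖ ^ 2 / r ^ 2)) (fun G hG a ha => ?_) hF z.2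
    · rw [ENNReal.ofReal_prod_of_nonneg, hardyENorm_sq, ← h]
      · refine h2.trans ?_
        rw [← eLpNorm_torusPoint_sq ⟨r, hr.le, hr1⟩ hF.continuousOn h]
        exact le_iSup (fun r : Set.Ico (0 : ℝ) 1 =>
          eLpNorm (fun θ => f (torusPoint r θ)) 2 (torusMeasure n) ^ 2) _
      · intro i _
        rw [sub_nonneg, div_le_one (by positivity)]
        have := (hz i).le
        gcongr
    -- The iteration asks for the estimate on the whole unit disc; for |a| ≥ r the constant is
    -- nonpositive and `ENNReal.ofReal` truncates it to 0.
    · rcases lt_or_ge ‖a‖ r with har | har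
      · refine (enorm_sq_le_lintegral_circle hr (hG.mono (Metric.closedBall_subset_ball hr1))
          har).trans ?_
        refine le_of_eq (lintegral_map' (f := fun w => ‖G w‖ₑ ^ 2) ?_
          (continuous_circleMap 0 r).aemeasurable).symm
        rw [← Measure.restrict_eq_self_of_ae_mem hμ]
        exact ((ENNReal.continuous_pow 2).comp_continuousOn
          hG.continuousOn.enorm).aemeasurable measurableSet_ball
      · have : 1 - ‖a‖ ^ 2 / r ^ 2 ≤ 0 := by
          rw [sub_nonpos, one_le_div (by positivity)]
          gcongr
        simp [ENNReal.ofReal_of_nonpos this]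
  -- Radii near 1 exceed the finitely many |zᵢ|, and the constant tends to the sharp one as r → 1.
  have hev : ∀ᶠ r : ℝ in 𝓝[<] 1, 0 < r ∧ r < 1 ∧ ∀ i, ‖z.1 i‖ < r := by
    refine (eventually_nhdsWithin_of_eventually_nhds (lt_mem_nhds one_pos)).and
      (eventually_mem_nhdsWithin.and (Filter.eventually_all.2 fun i => ?_))
    exact eventually_nhdsWithin_of_eventually_nhds (lt_mem_nhds (z.2 i))
  have hlim : Filter.Tendsto (fun r : ℝ => ENNReal.ofReal (∏ i, (1 - ‖z.1 i‖ ^ 2 / r ^ 2)))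
      (𝓝[<] 1) (𝓝 (ENNReal.ofReal (∏ i, (1 - ‖z.1 i‖ ^ 2 / 1 ^ 2)))) := by
    refine ENNReal.tendsto_ofReal (tendsto_finsetProd _ fun i _ => ?_)
    have : ContinuousAt (fun r : ℝ => 1 - ‖z.1 i‖ ^ 2 / r ^ 2) 1 := by
      fun_prop (disch := norm_num)
    exact this.tendsto.mono_left nhdsWithin_le_nhds
  have h3 := le_of_tendsto (ENNReal.Tendsto.mul_const hlim
    (Or.inr (ENNReal.pow_ne_top enorm_ne_top))) (hev.mono fun r hr => h1 r hr.1 hr.2.1 hr.2.2)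
  simpa using h3

theorem hardyENorm_productKernel_sq_le {w : Fin n → ℂ} (hw : w ∈ polydisc n) :
    hardyENorm (fun z : polydisc n => productKernel 1 w z) ^ 2
      ≤ ENNReal.ofReal (∏ i, (1 - ‖w i‖ ^ 2))⁻¹ := by
  rw [hardyENorm_sq]
  refine iSup_le fun r => ?_
  have := isProbabilityMeasure_map_circleMap r
  rw [eLpNorm_torusPoint_sq r (differentiableOn_productKernel 1 hw).continuousOn fun _ => rfl]
  refine (lintegral_pi_productKernel_le _ _ _).trans ?_
  rw [← Finset.prod_inv_distrib, ENNReal.ofReal_prod_of_nonneg fun i _ =>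
    inv_nonneg.2 (one_sub_norm_sq_pos (hw i)).le]
  refine Finset.prod_le_prod' fun i _ => ?_
  rw [lintegral_map (by fun_prop) (continuous_circleMap 0 (r : ℝ)).measurable]
  simp only [Complex.ofReal_one, Complex.cpow_neg_one]
  have hA := one_sub_norm_sq_pos (hw i)
  -- At r = 0 the circle degenerates to a point, where the kernel is 1; Cauchy's formula covers r >
  -- 0.
  rcases r.2.1.eq_or_lt with hr | hr
  · rw [← hr]
    simp only [circleMap_zero_radius, Function.const_apply, mul_zero, sub_zero, inv_one, enorm_one,
      one_pow, lintegral_one, measure_univ]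
    rw [← ENNReal.ofReal_one]
    refine ENNReal.ofReal_le_ofReal ((one_le_inv₀ hA).2 ?_)
    nlinarith [norm_nonneg (w i)]
  · rw [lintegral_circle_szego hr r.2.2 (hw i)]
    refine ENNReal.ofReal_le_ofReal (inv_anti₀ hA (sub_le_sub_left ?_ 1))
    exact mul_le_of_le_one_left (by positivity) (pow_le_one₀ hr.le r.2.2.le)

end Hardy

/-! ### Point values and kernel norm in the Bergman space. -/

section Bergman

variable {n : ℕ} {α : ℝ} {f : polydisc n → ℂ}

theorem volume_polydisc_ne_zero (n : ℕ) : volume (polydisc n) ≠ 0 :=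
  ((isOpen_polydisc n).measure_pos volume ⟨0, fun i => by simp⟩).ne'

theorem polydisc_eq_pi (n : ℕ) : polydisc n = Set.univ.pi fun _ => Metric.ball (0 : ℂ) 1 := by
  ext z
  simp [polydisc]

theorem volume_polydisc_ne_top (n : ℕ) : volume (polydisc n) ≠ ∞ := by
  rw [polydisc_eq_pi, volume_pi_pi]
  exact ENNReal.prod_ne_top fun _ _ => measure_ball_lt_top.ne

/-- The density is a product over coordinates, so the weighted volume is a power of `discMeasure α`
up to the normalizing constant. -/
theorem bergmanENorm_sq (hα : -1 < α) {F : (Fin n → ℂ) → ℂ} (h : ∀ z : polydisc n, F z = f z) :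
    bergmanENorm α f ^ 2 = (volume (polydisc n))⁻¹ *
      ∫⁻ x, (polydisc n).indicator (fun x => ‖F x‖ₑ ^ 2) x
        ∂(Measure.pi fun _ => discMeasure α) := by
  have hfin := isFiniteMeasure_discMeasure hα
  have hD := (isOpen_polydisc n).measurableSet
  have hρ : Measurable fun x : Fin n → ℂ => ∏ i, ENNReal.ofReal ((1 - ‖x i‖ ^ 2) ^ α) :=
    Finset.measurable_prod _ fun i _ => (measurable_discWeight α).comp (measurable_pi_apply i)
  have hw : ∀ z : polydisc n, ENNReal.ofReal (∏ i, (1 - ‖z.1 i‖ ^ 2) ^ α)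
      = ∏ i, ENNReal.ofReal ((1 - ‖z.1 i‖ ^ 2) ^ α) := fun z =>
    ENNReal.ofReal_prod_of_nonneg fun i _ =>
      (Real.rpow_pos_of_pos (one_sub_norm_sq_pos (z.2 i)) _).le
  have hpi : (Measure.pi fun _ : Fin n => discMeasure α)
      = (volume.restrict (polydisc n)).withDensity
        fun x => ∏ i, ENNReal.ofReal ((1 - ‖x i‖ ^ 2) ^ α) := by
    have : SigmaFinite ((volume.restrict (Metric.ball (0 : ℂ) 1)).withDensity fun z =>
        ENNReal.ofReal ((1 - ‖z‖ ^ 2) ^ α)) := inferInstanceAs (SigmaFinite (discMeasure α))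
    rw [polydisc_eq_pi, volume_pi, Measure.restrict_pi_pi]
    exact pi_withDensity _ (measurable_discWeight α)
  rw [bergmanENorm, eLpNorm_two_sq, bergmanMeasure]
  simp_rw [hw, ← h]
  rw [lintegral_withDensity_eq_lintegral_mul_non_measurable
      (f := fun z : polydisc n => ∏ i, ENNReal.ofReal ((1 - ‖z.1 i‖ ^ 2) ^ α)) _
      (hρ.comp measurable_subtype_coe)
    (.of_forall fun z => ENNReal.prod_lt_top fun i _ => ENNReal.ofReal_lt_top),
    lintegral_smul_measure, smul_eq_mul, hpi,
    lintegral_withDensity_eq_lintegral_mul_non_measurable _ hρ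
    (.of_forall fun z => ENNReal.prod_lt_top fun i _ => ENNReal.ofReal_lt_top)]
  congr 1
  refine (lintegral_subtype_comap hD (fun x : Fin n → ℂ =>
    (∏ i, ENNReal.ofReal ((1 - ‖x i‖ ^ 2) ^ α)) * ‖F x‖ₑ ^ 2)).trans ?_
  refine setLIntegral_congr_fun hD fun x hx => ?_
  simp [hx]

/-- The mass of the weighted volume measure on the polydisc. -/
noncomputable def bergmanMass (n : ℕ) (α : ℝ) : ℝ≥0∞ :=
  (volume (polydisc n))⁻¹ * discMeasure α Set.univ ^ n

theorem bergmanMass_ne_zero (n : ℕ) (α : ℝ) : bergmanMass n α ≠ 0 :=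
  mul_ne_zero (ENNReal.inv_ne_zero.2 (volume_polydisc_ne_top n))
    (pow_ne_zero _ (discMeasure_univ_ne_zero α))

theorem bergmanMass_ne_top (n : ℕ) (hα : -1 < α) : bergmanMass n α ≠ ∞ :=
  ENNReal.mul_ne_top (ENNReal.inv_ne_top.2 (volume_polydisc_ne_zero n))
    (ENNReal.pow_ne_top (discMeasure_univ_ne_top hα))

/-- The sharp bound of a point value by the weighted Bergman norm. -/
theorem enorm_sq_le_bergmanENorm_sq (hα : -1 < α) (hf : IsHolomorphic f) (z : polydisc n) :
    bergmanMass n α * ENNReal.ofReal (∏ i, (1 - ‖z.1 i‖ ^ 2) ^ (α + 2)) * ‖f z‖ₑ ^ 2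
      ≤ bergmanENorm α f ^ 2 := by
  have hfin := isFiniteMeasure_discMeasure hα
  obtain ⟨F, hF, h⟩ := hf
  have h1 := prod_mul_enorm_sq_le_lintegral_pi (discMeasure α) (ae_discMeasure_mem_ball α)
    (c := fun a => discMeasure α Set.univ * ENNReal.ofReal ((1 - ‖a‖ ^ 2) ^ (α + 2)))
    (fun G hG a ha => enorm_sq_le_lintegral_discMeasure α hG (mem_ball_zero_iff.1 ha)) hF z.2
  rw [Finset.prod_mul_distrib, Finset.prod_const, Finset.card_univ, Fintype.card_fin] at h1
  rw [bergmanENorm_sq hα h, bergmanMass, mul_assoc, mul_assoc, ← h, ← mul_assoc (_ ^ n),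
    ENNReal.ofReal_prod_of_nonneg fun i _ =>
      (Real.rpow_pos_of_pos (one_sub_norm_sq_pos (z.2 i)) _).le]
  gcongr

theorem bergmanENorm_productKernel_sq_le (hα : -1 < α) {w : Fin n → ℂ} (hw : w ∈ polydisc n) :
    bergmanENorm α (fun z : polydisc n => productKernel (α + 2) w z) ^ 2
      ≤ bergmanMass n α * ENNReal.ofReal (∏ i, (1 - ‖w i‖ ^ 2) ^ (α + 2))⁻¹ := by
  have hfin := isFiniteMeasure_discMeasure hα
  rw [bergmanENorm_sq hα (F := productKernel (α + 2) w) fun _ => rfl, bergmanMass, mul_assoc]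
  gcongr
  refine (lintegral_pi_productKernel_le _ _ _).trans (le_of_eq ?_)
  rw [← Finset.prod_inv_distrib, ENNReal.ofReal_prod_of_nonneg fun i _ =>
      inv_nonneg.2 (Real.rpow_pos_of_pos (one_sub_norm_sq_pos (hw i)) _).le,
    Finset.prod_congr rfl fun i _ => lintegral_discMeasure_kernel α (hw i),
    Finset.prod_mul_distrib, Finset.prod_const, Finset.card_univ, Fintype.card_fin]
  congr 1
  exact Finset.prod_congr rfl fun i _ => by rw [Real.rpow_neg (one_sub_norm_sq_pos (hw i)).le]

end Bergman

/-! ### Operator norm and conclusion. -/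

/-- Comparison of the norm of an operator with its effect on a kernel function `k`, where `v` is
the modulus of a value of the image of `k`. -/
theorem div_le_opNorm_sq {E : Type*} [NormedAddCommGroup E] [NormedSpace ℂ E] (C : E →L[ℂ] E)
    {k : E} {K : ℝ≥0∞} (hK0 : K ≠ 0) (hK : K ≠ ∞) {P Q : ℝ} (hP : 0 < P) (hQ : 0 < Q) {v : ℂ}
    (hv : ‖v‖ = Q⁻¹) (hCk : K * ENNReal.ofReal P * ‖v‖ₑ ^ 2 ≤ ENNReal.ofReal ‖C k‖ ^ 2)
    (hk : ENNReal.ofReal ‖k‖ ^ 2 ≤ K * ENNReal.ofReal Q⁻¹) : P / Q ≤ ‖C‖ ^ 2 := by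
  lift K to NNReal using hK
  have hK1 : (0 : ℝ) < K := by
    rw [NNReal.coe_pos, pos_iff_ne_zero]
    exact_mod_cast hK0
  rw [← ofReal_norm, hv, ← ENNReal.ofReal_coe_nnreal, ← ENNReal.ofReal_pow (by positivity),
    ← ENNReal.ofReal_pow (by positivity), ← ENNReal.ofReal_mul (by positivity),
    ← ENNReal.ofReal_mul (by positivity), ENNReal.ofReal_le_ofReal_iff (by positivity)] at hCk
  rw [← ENNReal.ofReal_coe_nnreal, ← ENNReal.ofReal_pow (by positivity),
    ← ENNReal.ofReal_mul (by positivity), ENNReal.ofReal_le_ofReal_iff (by positivity)] at hk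
  have h1 : ‖C k‖ ^ 2 ≤ ‖C‖ ^ 2 * ‖k‖ ^ 2 := by
    rw [← mul_pow]
    gcongr
    exact C.le_opNorm k
  -- The common factor K/Q, the bound for ‖k‖², is positive and is cancelled at the end.
  have h2 : (K * Q⁻¹) * (P / Q) ≤ (K * Q⁻¹) * ‖C‖ ^ 2 := by
    calc (K * Q⁻¹) * (P / Q) = K * P * Q⁻¹ ^ 2 := by ring
      _ ≤ ‖C‖ ^ 2 * ‖k‖ ^ 2 := hCk.trans h1
      _ ≤ ‖C‖ ^ 2 * (K * Q⁻¹) := by gcongr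
      _ = _ := mul_comm _ _
  exact le_of_mul_le_mul_left h2 (by positivity)

theorem polydisc_nonempty (n : ℕ) : Nonempty (polydisc n) := ⟨⟨0, fun i => by simp⟩⟩

theorem bddAbove_and_iSup_le {ι : Type*} [Nonempty ι] {f : ι → ℝ} {b : ℝ} (h : ∀ i, f i ≤ b) :
    BddAbove (Set.range f) ∧ ⨆ i, f i ≤ b :=
  ⟨⟨b, Set.forall_mem_range.2 h⟩, ciSup_le h⟩

theorem HardySpace.ofReal_norm_eq {n : ℕ} (f : HardySpace n) :
    ENNReal.ofReal ‖f‖ = hardyENorm (f : polydisc n → ℂ) := by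
  rw [HardySpace.norm_def, ENNReal.ofReal_toReal f.2.2.ne]

theorem BergmanSpace.ofReal_norm_eq {n : ℕ} {α : ℝ} (f : BergmanSpace n α) :
    ENNReal.ofReal ‖f‖ = bergmanENorm α (f : polydisc n → ℂ) := by
  rw [BergmanSpace.norm_def, ENNReal.ofReal_toReal f.2.2.ne]

/-- A bounded operator `C` with `C f = f ∘ φ` for all `f` is the bounded composition operator
`C_φ`. -/
theorem corollary5p2 (n : ℕ) (φ : polydisc n → polydisc n)
    (hφ : ∀ i, IsHolomorphic fun z => (φ z).1 i) :
    (∀ C : HardySpace n →L[ℂ] HardySpace n, (∀ f z, C f z = f (φ z)) →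
      BddAbove (Set.range fun z : polydisc n =>
        ∏ i, (1 - ‖z.1 i‖ ^ 2) / (1 - ‖(φ z).1 i‖ ^ 2)) ∧
      ⨆ z : polydisc n, ∏ i, (1 - ‖z.1 i‖ ^ 2) / (1 - ‖(φ z).1 i‖ ^ 2) ≤ ‖C‖ ^ 2) ∧
    (∀ α : ℝ, -1 < α →
      ∀ C : BergmanSpace n α →L[ℂ] BergmanSpace n α, (∀ f z, C f z = f (φ z)) →
      BddAbove (Set.range fun z : polydisc n =>
        ∏ i, ((1 - ‖z.1 i‖ ^ 2) / (1 - ‖(φ z).1 i‖ ^ 2)) ^ (α + 2)) ∧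
      ⨆ z : polydisc n, ∏ i, ((1 - ‖z.1 i‖ ^ 2) / (1 - ‖(φ z).1 i‖ ^ 2)) ^ (α + 2)
        ≤ ‖C‖ ^ 2) := by
  have := polydisc_nonempty n
  refine ⟨fun C hC => bddAbove_and_iSup_le fun z => ?_,
    fun α hα C hC => bddAbove_and_iSup_le fun z => ?_⟩
  · have hw := (φ z).2
    have hk := hardyENorm_productKernel_sq_le hw
    -- The pole is φ(z), so the value of C k at z is the kernel at its own pole.
    let k : HardySpace n := ⟨fun u => productKernel 1 (φ z).1 u, isHolomorphic_productKernel 1 hw,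
      ENNReal.pow_lt_top_iff.1 (hk.trans_lt ENNReal.ofReal_lt_top) |>.resolve_right two_ne_zero⟩
    rw [Finset.prod_div_distrib]
    refine div_le_opNorm_sq C (k := k) (K := 1) (v := k (φ z)) one_ne_zero ENNReal.one_ne_top
      (Finset.prod_pos fun i _ => one_sub_norm_sq_pos (z.2 i))
      (Finset.prod_pos fun i _ => one_sub_norm_sq_pos (hw i)) ?_ ?_ ?_
    · simpa using norm_productKernel_self 1 hw
    · rw [one_mul, HardySpace.ofReal_norm_eq, ← hC k z]
      exact enorm_sq_le_hardyENorm_sq (C k).2.1 z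
    · rw [one_mul, HardySpace.ofReal_norm_eq]
      exact hk
  · have hw := (φ z).2
    have hk := bergmanENorm_productKernel_sq_le hα hw
    let k : BergmanSpace n α := ⟨fun u => productKernel (α + 2) (φ z).1 u,
      isHolomorphic_productKernel _ hw, ENNReal.pow_lt_top_iff.1 (hk.trans_lt
        (ENNReal.mul_lt_top (bergmanMass_ne_top n hα).lt_top ENNReal.ofReal_lt_top))
        |>.resolve_right two_ne_zero⟩
    rw [Finset.prod_congr rfl fun i _ => Real.div_rpow (one_sub_norm_sq_pos (z.2 i)).le
      (one_sub_norm_sq_pos (hw i)).le _, Finset.prod_div_distrib]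
    refine div_le_opNorm_sq C (k := k) (v := k (φ z)) (bergmanMass_ne_zero n α)
      (bergmanMass_ne_top n hα) (prod_rpow_one_sub_norm_sq_pos _ z.2)
      (prod_rpow_one_sub_norm_sq_pos _ hw) (norm_productKernel_self _ hw) ?_ ?_
    · rw [BergmanSpace.ofReal_norm_eq, ← hC k z]
      exact enorm_sq_le_bergmanENorm_sq hα (C k).2.1 z
    · rw [BergmanSpace.ofReal_norm_eq]
      exact hk
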